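/- The \emph{triangular grid} is the graph with vertex set $\mathbb{Z}^2$ in which $u$ and $v$ are adjacent if and only if $u-v\in\{(\pm1,0),(0,\pm1),(1,1),(-1,-1)\}$. For a vertex $u$ let $N_r(u)$ be the set of vertices at graph distance at most $r$ from $u$. For non-negative integers $a,b$, a set $S\subseteq\mathbb{Z}^2$ is an \emph{$(r,b,a)$-covering} in the triangular grid if $|N_r(u)\cap S|=b$ for every $u\in S$ and $|N_r(u)\cap S|=a$ for every $u\in\mathbb{Z}^2\setminus S$. For $D\subseteq\mathbb{Z}^2$ finite, a configuration $c\in\{0,1\}^{\mathbb{Z}^2}$ is a \emph{$(D,b,a)$-covering} if, for every $u\in\mathbb{Z}^2$, the set $u+D$ contains exactly $b$ points $v$ with $c_v=1$ when $c_u=1$, and exactly $a$ such points when $c_u=0$. A configuration $c$ (respectively a set $S$) is \emph{two-periodic} if there are linearly independent $t_1,t_2\in\mathbb{Z}^2$ such that $c_{u-t_i}=c_u$ for all $u\in\mathbb{Z}^2$ (respectively $S=S+t_i$) for $i=1,2$. \textbf{Theorem.} Let $r\ge 2$, let $a,b$ be non-negative integers, and let $D=N_r((0,0))$ be the $r$-neighborhood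 of the origin in the triangular grid. Then every $(D,b,a)$-covering $c\in\{0,1\}^{\mathbb{Z}^2}$ is two-periodic. In other words, every $(r,b,a)$-covering $S\subseteq\mathbb{Z}^2$ in the triangular grid is two-periodic. -/

import Mathlib

namespace PerfectCovering

/-- The closed `r`-neighborhood of a vertex `u`: all vertices at graph distance at most `r`
from `u`. The extended distance is used, so that unreachable vertices are excluded. -/
def neighborhood {V : Type*} (G : SimpleGraph V) (r : ℕ) (u : V) : Set V :=
  {v | G.edist v u ≤ (r : ℕ∞)}

/-- A code `S` in a graph `G` is an `(r, b, a)`-covering if the `r`-neighborhood of every vertex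
in `S` contains exactly `b` elements of `S` and the `r`-neighborhood of every vertex not in `S`
contains exactly `a` elements of `S`. -/
def IsCodeCovering {V : Type*} (G : SimpleGraph V) (r b a : ℕ) (S : Set V) : Prop :=
  ∀ u : V,
    (u ∈ S → (neighborhood G r u ∩ S).encard = (b : ℕ∞)) ∧
    (u ∉ S → (neighborhood G r u ∩ S).encard = (a : ℕ∞))

/-- A binary configuration `c` is a `(D, b, a)`-covering if for all `u` the pattern of `c` on
`u + D` contains exactly `b` symbols `1` if `c u = 1` and exactly `a` symbols `1` if `c u = 0`. -/
def IsConfigCovering (D : Set (ℤ × ℤ)) (b a : ℕ) (c : ℤ × ℤ → Fin 2) : Prop :=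
  ∀ u : ℤ × ℤ,
    (c u = 1 → {v | v ∈ (fun d => u + d) '' D ∧ c v = 1}.encard = (b : ℕ∞)) ∧
    (c u = 0 → {v | v ∈ (fun d => u + d) '' D ∧ c v = 1}.encard = (a : ℕ∞))

/-- The translation of a configuration `c` by the vector `t`. -/
def translate {A : Type*} (t : ℤ × ℤ) (c : ℤ × ℤ → A) : ℤ × ℤ → A :=
  fun u => c (u - t)

/-- A configuration is two-periodic if it has two linearly independent vectors of periodicity. -/
def ConfigTwoPeriodic {A : Type*} (c : ℤ × ℤ → A) : Prop :=
  ∃ t₁ t₂ : ℤ × ℤ, LinearIndependent ℤ ![t₁, t₂] ∧ translate t₁ c = c ∧ translate t₂ c = c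

/-- A code `S ⊆ ℤ²` is two-periodic if `S = S + t₁` and `S = S + t₂` for some linearly
independent `t₁` and `t₂`. -/
def CodeTwoPeriodic (S : Set (ℤ × ℤ)) : Prop :=
  ∃ t₁ t₂ : ℤ × ℤ, LinearIndependent ℤ ![t₁, t₂] ∧
    S = (fun s => s + t₁) '' S ∧ S = (fun s => s + t₂) '' S

/-- The triangular grid on `ℤ²`: `u` and `v` are adjacent if and only if `u - v` is one of
`(±1, 0)`, `(0, ±1)`, `(1, 1)`, `(-1, -1)`. -/
def triangularGrid : SimpleGraph (ℤ × ℤ) where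
  Adj u v := u - v ∈ ({(1, 0), (-1, 0), (0, 1), (0, -1), (1, 1), (-1, -1)} : Set (ℤ × ℤ))
  symm := ⟨by
    intro u v h
    simp only [Set.mem_insert_iff, Set.mem_singleton_iff, Prod.ext_iff, Prod.fst_sub,
      Prod.snd_sub] at h ⊢
    omega⟩
  loopless := ⟨by
    intro u h
    simp [Prod.ext_iff] at h⟩

end PerfectCovering

/-!
The `r`-neighborhood of a vertex in the triangular grid is a translate of the hexagon
`|x| ≤ r`, `|y| ≤ r`, `|x - y| ≤ r`, so the indicator function `F` of a covering satisfies
`∑ k ∈ hexagon r, F (z + k) = a + (b - a) * F z`. The difference `d` of two such functions takes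
values in `{-1, 0, 1}` and satisfies the homogeneous equation
`∑ k ∈ hexagon r, d (z + k) = (b - a) * d z`.

The key fact (`IsHexEigen.eq_zero`) is that such a `d` vanishes everywhere as soon as it vanishes
on one sufficiently large hexagon; the hexagon on which `d` vanishes can be enlarged step by step.
Let `d` vanish on `hexagon n`, and let `e` and `g` be the restrictions of `d` to the rows `n + 1`
and `n + 2`. The top row of `hexagon r` has `r + 1` points, so the equation centered at height
`n + 1 - r` says that `r + 1` consecutive values of `e` add up to `0`; in particular `e` has period
`r + 1`. The row below it has `r + 2` points, so the equation centered at height `n + 2 - r`, which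
is at most `n` because `2 ≤ r`, says that `r + 1` consecutive values of `g` add up to the negative
of one value of `e`. Hence `g (x + (r + 1)) - g x = e (x - 1) - e x`, and the right-hand side has
period `r + 1`: `g` drifts linearly, which its boundedness forbids unless `e` is constant, and then
`e = 0` (`eq_zero_of_window_sums`). The rotations by multiples of sixty degrees turn this into a
statement about all six sides, and a single equation settles each corner.

A covering is therefore determined by its restriction to a fixed finite hexagon. Among the
translates of a covering by the multiples of a vector two agree on this hexagon, hence are equal,
and this yields a period in every direction (`IsCodeCovering.exists_period`).
-/

namespace PerfectCovering

open Finset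

/-! ### Hexagons and neighborhoods in the triangular grid -/

/-- The lattice points of the hexagon `|x| ≤ n`, `|y| ≤ n`, `|x - y| ≤ n`. -/
noncomputable def hexagon (n : ℤ) : Finset (ℤ × ℤ) :=
  (Icc (-n) n ×ˢ Icc (-n) n).filter fun p => -n ≤ p.1 - p.2 ∧ p.1 - p.2 ≤ n

lemma mem_hexagon {n : ℤ} {p : ℤ × ℤ} :
    p ∈ hexagon n ↔ (-n ≤ p.1 ∧ p.1 ≤ n) ∧ (-n ≤ p.2 ∧ p.2 ≤ n) ∧
      (-n ≤ p.1 - p.2 ∧ p.1 - p.2 ≤ n) := by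
  simp [hexagon, and_assoc]

lemma triangularGrid_adj {u v : ℤ × ℤ} :
    triangularGrid.Adj u v ↔
      (u.1 - v.1 = 1 ∧ u.2 - v.2 = 0) ∨ (u.1 - v.1 = -1 ∧ u.2 - v.2 = 0) ∨
      (u.1 - v.1 = 0 ∧ u.2 - v.2 = 1) ∨ (u.1 - v.1 = 0 ∧ u.2 - v.2 = -1) ∨
      (u.1 - v.1 = 1 ∧ u.2 - v.2 = 1) ∨ (u.1 - v.1 = -1 ∧ u.2 - v.2 = -1) := by
  simp [triangularGrid, Prod.ext_iff]

lemma sub_mem_hexagon_of_walk {u v : ℤ × ℤ} (w : triangularGrid.Walk v u) :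
    v - u ∈ hexagon w.length := by
  induction w with
  | nil => simp [mem_hexagon]
  | cons h w ih =>
    rw [triangularGrid_adj] at h
    rw [mem_hexagon] at ih ⊢
    simp only [SimpleGraph.Walk.length_cons, Prod.fst_sub, Prod.snd_sub] at ih ⊢
    push_cast
    omega

lemma edist_le_of_sub_mem_hexagon (n : ℕ) (u v : ℤ × ℤ) (h : v - u ∈ hexagon n) :
    triangularGrid.edist v u ≤ n := by
  induction n generalizing v with
  | zero =>
    have : v = u := by
      rw [mem_hexagon] at h
      simp only [Prod.fst_sub, Prod.snd_sub] at h
      ext <;> push_cast at h <;> omega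
    simp [this]
  | succ n ih =>
    by_cases hv : v - u ∈ hexagon n
    · exact (ih v hv).trans (by exact_mod_cast n.le_succ)
    -- Some neighbor of a point of the boundary of a hexagon lies in the next smaller hexagon.
    obtain ⟨v', hadj, hv'⟩ : ∃ v', triangularGrid.Adj v v' ∧ v' - u ∈ hexagon n := by
      simp only [triangularGrid_adj, mem_hexagon, Prod.fst_sub, Prod.snd_sub] at h hv ⊢
      push_cast at h
      rcases lt_trichotomy (v.1 - u.1) 0 with hx | hx | hx <;>
        rcases lt_trichotomy (v.2 - u.2) 0 with hy | hy | hy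
      · exact ⟨(v.1 + 1, v.2 + 1), by dsimp only; omega, by dsimp only; omega⟩
      · exact ⟨(v.1 + 1, v.2), by dsimp only; omega, by dsimp only; omega⟩
      · exact ⟨(v.1 + 1, v.2), by dsimp only; omega, by dsimp only; omega⟩
      · exact ⟨(v.1, v.2 + 1), by dsimp only; omega, by dsimp only; omega⟩
      · omega
      · exact ⟨(v.1, v.2 - 1), by dsimp only; omega, by dsimp only; omega⟩
      · exact ⟨(v.1 - 1, v.2), by dsimp only; omega, by dsimp only; omega⟩
      · exact ⟨(v.1 - 1, v.2), by dsimp only; omega, by dsimp only; omega⟩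
      · exact ⟨(v.1 - 1, v.2 - 1), by dsimp only; omega, by dsimp only; omega⟩
    calc triangularGrid.edist v u
        ≤ triangularGrid.edist v v' + triangularGrid.edist v' u :=
          SimpleGraph.edist_triangle
      _ ≤ 1 + n := add_le_add (SimpleGraph.edist_eq_one_iff_adj.2 hadj).le (ih v' hv')
      _ = ((n + 1 : ℕ) : ℕ∞) := by push_cast; ring

lemma mem_neighborhood_triangularGrid {r : ℕ} {u v : ℤ × ℤ} :
    v ∈ neighborhood triangularGrid r u ↔ v - u ∈ hexagon r := by
  refine ⟨fun h => ?_, edist_le_of_sub_mem_hexagon r u v⟩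
  have h' : triangularGrid.edist v u ≤ r := h
  obtain ⟨w, hw⟩ := SimpleGraph.exists_walk_of_edist_ne_top
    (ne_top_of_le_ne_top (ENat.natCast_ne_top r) h')
  rw [← hw] at h'
  have hle : (w.length : ℤ) ≤ r := by exact_mod_cast h'
  have := sub_mem_hexagon_of_walk w
  rw [mem_hexagon] at this ⊢
  omega

/-! ### Two consecutive rows -/

/-- If the windows of length `r + 1` of `e` have sum `0` and those of the bounded function `g`
compensate the windows of length `r + 2` of `e`, then `e` vanishes: otherwise `g` would drift
linearly along the multiples of `r + 1`. -/
lemma eq_zero_of_window_sums {r : ℕ} {n : ℤ} (hn : 8 * r + 8 ≤ n) {e g : ℤ → ℤ}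
    (hg : ∀ x, |g x| ≤ 1)
    (hE : ∀ x, 1 ≤ x → x ≤ n - r → ∑ i ∈ range (r + 1), e (x + i) = 0)
    (hG : ∀ x, 2 ≤ x → x ≤ n - r →
      ∑ i ∈ range (r + 1), g (x + i) + ∑ i ∈ range (r + 2), e (x - 1 + i) = 0)
    {x : ℤ} (hx : 1 ≤ x) (hxn : x ≤ n) : e x = 0 := by
  have shift (f : ℤ → ℤ) (x : ℤ) : ∑ i ∈ range (r + 1), f (x + 1 + i) + f x =
      ∑ i ∈ range (r + 1), f (x + i) + f (x + (r + 1)) := by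
    have h1 := Finset.sum_range_succ (fun i : ℕ => f (x + i)) (r + 1)
    have h2 := Finset.sum_range_succ' (fun i : ℕ => f (x + i)) (r + 1)
    rw [h1] at h2
    push_cast at h2
    rw [h2, add_zero]
    congr 1
    exact Finset.sum_congr rfl fun i _ => by congr 1; ring
  have window (x : ℤ) : ∑ i ∈ range (r + 2), e (x - 1 + i) =
      ∑ i ∈ range (r + 1), e (x + i) + e (x - 1) := by
    rw [Finset.sum_range_succ' _ (r + 1)]
    push_cast
    rw [add_zero]
    congr 1
    exact Finset.sum_congr rfl fun i _ => by congr 1; ring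
  have hper (x : ℤ) (h1 : 1 ≤ x) (h2 : x + 1 ≤ n - r) : e (x + (r + 1)) = e x := by
    have := shift e x
    rw [hE x h1 (by omega), hE (x + 1) (by omega) h2] at this
    omega
  have hGe (x : ℤ) (h1 : 2 ≤ x) (h2 : x ≤ n - r) :
      ∑ i ∈ range (r + 1), g (x + i) = -e (x - 1) := by
    have := hG x h1 h2
    rw [window, hE x (by omega) h2] at this
    omega
  have hdrift (x : ℤ) (h1 : 2 ≤ x) (h2 : x + 1 ≤ n - r) :
      g (x + (r + 1)) = g x + (e (x - 1) - e x) := by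
    have := shift g x
    rw [hGe x h1 (by omega), hGe (x + 1) (by omega) h2, add_sub_cancel_right] at this
    omega
  have hconst (x : ℤ) (h1 : 2 ≤ x) (h2 : x ≤ r + 2) : e x = e (x - 1) := by
    have d0 := hdrift x h1 (by omega)
    have d1 := hdrift (x + (r + 1)) (by omega) (by omega)
    have d2 := hdrift (x + (r + 1) + (r + 1)) (by omega) (by omega)
    have p0 := hper x (by omega) (by omega)
    have p1 := hper (x + (r + 1)) (by omega) (by omega)
    have q0 := hper (x - 1) (by omega) (by omega)
    have q1 := hper (x - 1 + (r + 1)) (by omega) (by omega)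
    rw [show x - 1 + (r + 1) = x + ((r : ℤ) + 1) - 1 by ring] at q0 q1
    rw [show x + ((r : ℤ) + 1) - 1 + (r + 1) = x + ((r : ℤ) + 1) + (r + 1) - 1 by ring] at q1
    -- The total drift over three steps is `3 * (e (x - 1) - e x)`, but it is at most `2`.
    have b0 := abs_le.1 (hg x)
    have b1 := abs_le.1 (hg (x + (r + 1) + (r + 1) + (r + 1)))
    omega
  have hfirst (k : ℕ) (hk : k ≤ r + 1) : e (1 + k) = e 1 := by
    induction k with
    | zero => simp
    | succ k ih =>
      rw [← ih (by omega), hconst (1 + (k + 1 : ℕ)) (by push_cast; omega) (by push_cast; omega)]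
      congr 1
      push_cast
      ring
  have he1 : e 1 = 0 := by
    have h := hE 1 le_rfl (by omega)
    rw [Finset.sum_congr rfl fun i hi => hfirst i (by rw [Finset.mem_range] at hi; omega)] at h
    simp only [Finset.sum_const, Finset.card_range, nsmul_eq_mul, mul_eq_zero] at h
    exact h.resolve_left (by positivity)
  have key (k : ℕ) : ∀ x, 1 ≤ x → x ≤ n → x ≤ k → e x = 0 := by
    induction k with
    | zero => intro x h1 _ h3; push_cast at h3; omega
    | succ k ih =>
      intro x h1 h2 h3
      push_cast at h3
      by_cases hxr : x ≤ r + 1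
      · have := hfirst (x - 1).toNat (by omega)
        rwa [show 1 + (((x - 1).toNat : ℕ) : ℤ) = x by omega, he1] at this
      · have := hper (x - (r + 1)) (by omega) (by omega)
        rw [sub_add_cancel] at this
        rw [this]
        exact ih _ (by omega) (by omega) (by omega)
  exact key x.toNat x hx hxn (by omega)

/-! ### Bounded solutions of the homogeneous equation -/

/-- The rotation of the triangular grid by sixty degrees about the origin. -/
def rot : ℤ × ℤ ≃ ℤ × ℤ where
  toFun p := (p.1 - p.2, p.1)
  invFun p := (p.2, p.2 - p.1)
  left_inv p := by simp
  right_inv p := by simp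

lemma rot_apply (x y : ℤ) : rot (x, y) = (x - y, x) := rfl

lemma rot_mem_hexagon {n : ℤ} {p : ℤ × ℤ} : rot p ∈ hexagon n ↔ p ∈ hexagon n := by
  obtain ⟨x, y⟩ := p
  simp only [rot_apply, mem_hexagon]
  omega

/-- `d` takes values in `{-1, 0, 1}` and is an eigenfunction, with eigenvalue `m`, of summation
over the translates of `hexagon r`. -/
structure IsHexEigen (r : ℕ) (m : ℤ) (d : ℤ × ℤ → ℤ) : Prop where
  abs_le : ∀ z, |d z| ≤ 1
  sum_eq : ∀ z, ∑ k ∈ hexagon r, d (z + k) = m * d z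

variable {r : ℕ} {m n : ℤ} {d : ℤ × ℤ → ℤ}

lemma IsHexEigen.comp_rot (h : IsHexEigen r m d) : IsHexEigen r m (d ∘ rot) where
  abs_le z := h.abs_le _
  sum_eq z := by
    rw [Function.comp_apply, ← h.sum_eq]
    refine Finset.sum_equiv rot (fun _ => rot_mem_hexagon.symm) fun k _ => ?_
    rw [Function.comp_apply]
    congr 1
    ext <;> simp [rot]
    ring

lemma sum_hexagon_eq_top_row {h : ℤ × ℤ → ℤ} (hr : 0 < r)
    (h0 : ∀ p ∈ hexagon r, p.2 < r → h p = 0) :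
    ∑ p ∈ hexagon r, h p = ∑ i ∈ range (r + 1), h ((i : ℤ), (r : ℤ)) := by
  rw [← Finset.sum_image (f := h) (g := fun i : ℕ => ((i : ℤ), (r : ℤ)))
    (fun i _ j _ hij => by simpa using hij)]
  refine (Finset.sum_subset (fun p hp => ?_) fun p hp hnot => h0 p hp ?_).symm
  · obtain ⟨i, hi, rfl⟩ := Finset.mem_image.1 hp
    rw [Finset.mem_range] at hi
    simp only [mem_hexagon]
    omega
  · by_contra hlt
    rw [mem_hexagon] at hp
    refine hnot (Finset.mem_image.2 ⟨p.1.toNat, Finset.mem_range.2 (by omega), ?_⟩)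
    ext <;> dsimp only <;> omega

lemma sum_hexagon_eq_top_two_rows {h : ℤ × ℤ → ℤ} (hr : 0 < r)
    (h0 : ∀ p ∈ hexagon r, p.2 < r - 1 → h p = 0) :
    ∑ p ∈ hexagon r, h p = ∑ i ∈ range (r + 1), h ((i : ℤ), (r : ℤ)) +
      ∑ i ∈ range (r + 2), h ((i : ℤ) - 1, (r : ℤ) - 1) := by
  rw [← Finset.sum_image (f := h) (g := fun i : ℕ => ((i : ℤ), (r : ℤ)))
    (fun i _ j _ hij => by simpa using hij),
    ← Finset.sum_image (f := h) (g := fun i : ℕ => ((i : ℤ) - 1, (r : ℤ) - 1))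
    (fun i _ j _ hij => by simpa using hij), ← Finset.sum_union]
  · refine (Finset.sum_subset (fun p hp => ?_) fun p hp hnot => h0 p hp ?_).symm
    · rcases Finset.mem_union.1 hp with hp | hp <;>
      · obtain ⟨i, hi, rfl⟩ := Finset.mem_image.1 hp
        rw [Finset.mem_range] at hi
        simp only [mem_hexagon]
        omega
    · by_contra hlt
      rw [mem_hexagon] at hp
      refine hnot (Finset.mem_union.2 ?_)
      by_cases hp2 : p.2 = r
      · refine Or.inl (Finset.mem_image.2 ⟨p.1.toNat, Finset.mem_range.2 (by omega), ?_⟩)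
        ext <;> dsimp only <;> omega
      · refine Or.inr (Finset.mem_image.2 ⟨(p.1 + 1).toNat, Finset.mem_range.2 (by omega), ?_⟩)
        ext <;> dsimp only <;> omega
  · refine Finset.disjoint_left.2 fun p hp hp' => ?_
    obtain ⟨i, -, rfl⟩ := Finset.mem_image.1 hp
    obtain ⟨j, -, hj⟩ := Finset.mem_image.1 hp'
    have := congrArg Prod.snd hj
    dsimp only at this
    omega

/-- The hypothesis `2 ≤ r` puts the center of a hexagon whose top row has height `n + 2` inside
`hexagon n`, so that the eigenvalue plays no role. -/
lemma IsHexEigen.top_side (h : IsHexEigen r m d) (hr : 2 ≤ r) (hn : 8 * r + 8 ≤ n)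
    (h0 : ∀ p ∈ hexagon n, d p = 0) {x : ℤ} (hx : 1 ≤ x) (hxn : x ≤ n) :
    d (x, n + 1) = 0 := by
  refine eq_zero_of_window_sums (e := fun x => d (x, n + 1)) (g := fun x => d (x, n + 2)) hn
    (fun x => h.abs_le _) (fun x h1 h2 => ?_) (fun x h1 h2 => ?_) hx hxn
  · have hs := h.sum_eq (x, n + 1 - r)
    rw [h0 (x, n + 1 - r) (by simp only [mem_hexagon]; omega), mul_zero,
      sum_hexagon_eq_top_row (by omega)] at hs
    · simpa using hs
    · intro p hp hp2
      refine h0 _ ?_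
      simp only [mem_hexagon, Prod.fst_add, Prod.snd_add] at hp ⊢
      omega
  · have hs := h.sum_eq (x, n + 2 - r)
    rw [h0 (x, n + 2 - r) (by simp only [mem_hexagon]; omega), mul_zero,
      sum_hexagon_eq_top_two_rows (by omega)] at hs
    · rw [← hs]
      congr 1 <;>
      · refine Finset.sum_congr rfl fun i _ => congrArg d ?_
        ext <;> simp only [Prod.fst_add, Prod.snd_add] <;> ring
    · intro p hp hp2
      refine h0 _ ?_
      simp only [mem_hexagon, Prod.fst_add, Prod.snd_add] at hp ⊢
      omega

lemma comp_rot_eq_zero (h0 : ∀ p ∈ hexagon n, d p = 0) :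
    ∀ p ∈ hexagon n, (d ∘ rot) p = 0 :=
  fun _ hp => h0 _ (rot_mem_hexagon.2 hp)

lemma IsHexEigen.right_side (h : IsHexEigen r m d) (hr : 2 ≤ r) (hn : 8 * r + 8 ≤ n)
    (h0 : ∀ p ∈ hexagon n, d p = 0) {y : ℤ} (hy : 1 ≤ y) (hyn : y ≤ n) :
    d (n + 1, y) = 0 := by
  have := h.comp_rot.comp_rot.comp_rot.comp_rot.comp_rot.top_side hr hn
    (comp_rot_eq_zero <| comp_rot_eq_zero <| comp_rot_eq_zero <| comp_rot_eq_zero <|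
      comp_rot_eq_zero h0) (x := n + 1 - y) (by omega) (by omega)
  simp only [Function.comp_apply, rot_apply] at this
  rw [← this]
  congr 2 <;> ring

/-- In the translate of `hexagon r` whose upper right corner is `(n + 1, n + 1)`, all other points
lie in `hexagon n` or on the two adjacent sides, where `d` is already known to vanish. -/
lemma IsHexEigen.corner (h : IsHexEigen r m d) (hr : 2 ≤ r) (hn : 8 * r + 8 ≤ n)
    (h0 : ∀ p ∈ hexagon n, d p = 0) : d (n + 1, n + 1) = 0 := by
  have hs := h.sum_eq (n + 1 - r, n + 1 - r)
  rw [h0 (n + 1 - r, n + 1 - r) (by simp only [mem_hexagon]; omega), mul_zero,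
    Finset.sum_eq_single ((r : ℤ), (r : ℤ))] at hs
  · simpa using hs
  · intro p hp hne
    obtain ⟨i, j⟩ := p
    rw [Ne, Prod.mk.injEq] at hne
    simp only [mem_hexagon] at hp
    rw [Prod.mk_add_mk]
    by_cases hj : j = r
    · rw [show n + 1 - (r : ℤ) + j = n + 1 by omega]
      exact h.top_side hr hn h0 (by omega) (by omega)
    by_cases hi : i = r
    · rw [show n + 1 - (r : ℤ) + i = n + 1 by omega]
      exact h.right_side hr hn h0 (by omega) (by omega)
    · refine h0 _ ?_
      simp only [mem_hexagon]
      omega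
  · intro hnot
    refine absurd ?_ hnot
    simp only [mem_hexagon]
    omega

lemma IsHexEigen.eq_zero_on_succ (h : IsHexEigen r m d) (hr : 2 ≤ r) (hn : 8 * r + 8 ≤ n)
    (h0 : ∀ p ∈ hexagon n, d p = 0) : ∀ p ∈ hexagon (n + 1), d p = 0 := by
  -- Each half-open side is the image of the top one under a power of the rotation.
  have side {d' : ℤ × ℤ → ℤ} (h : IsHexEigen r m d') (h0 : ∀ p ∈ hexagon n, d' p = 0)
      (x : ℤ) (hx : 1 ≤ x) (hxn : x ≤ n + 1) : d' (x, n + 1) = 0 := by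
    rcases hxn.eq_or_lt with rfl | hlt
    · exact h.corner hr hn h0
    · exact h.top_side hr hn h0 hx (by omega)
  have z1 := comp_rot_eq_zero h0
  have z2 := comp_rot_eq_zero z1
  have z3 := comp_rot_eq_zero z2
  have z4 := comp_rot_eq_zero z3
  have z5 := comp_rot_eq_zero z4
  have s0 := side h h0
  have s1 := side h.comp_rot z1
  have s2 := side h.comp_rot.comp_rot z2
  have s3 := side h.comp_rot.comp_rot.comp_rot z3
  have s4 := side h.comp_rot.comp_rot.comp_rot.comp_rot z4
  have s5 := side h.comp_rot.comp_rot.comp_rot.comp_rot.comp_rot z5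
  simp only [Function.comp_apply, rot_apply] at s1 s2 s3 s4 s5
  rintro ⟨x, y⟩ hp
  by_cases hpn : (x, y) ∈ hexagon n
  · exact h0 _ hpn
  simp only [mem_hexagon] at hp hpn
  have hcases : (y = n + 1 ∧ 1 ≤ x) ∨ (y - x = n + 1 ∧ 1 ≤ y) ∨ (x = -(n + 1) ∧ 1 ≤ y - x) ∨
      (y = -(n + 1) ∧ 1 ≤ -x) ∨ (x - y = n + 1 ∧ 1 ≤ -y) ∨ (x = n + 1 ∧ 1 ≤ x - y) := by
    omega
  rcases hcases with ⟨h1, h2⟩ | ⟨h1, h2⟩ | ⟨h1, h2⟩ | ⟨h1, h2⟩ | ⟨h1, h2⟩ | ⟨h1, h2⟩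
  · rw [← s0 x h2 (by omega), h1]
  · rw [← s1 y h2 (by omega)]; congr 2; omega
  · rw [← s2 (y - x) h2 (by omega)]; congr 2 <;> omega
  · rw [← s3 (-x) h2 (by omega)]; congr 2 <;> omega
  · rw [← s4 (-y) h2 (by omega)]; congr 2 <;> omega
  · rw [← s5 (x - y) h2 (by omega)]; congr 2 <;> omega

/-- An eigenfunction with values in `{-1, 0, 1}` is determined by its values on a hexagon whose
size depends only on `r`. -/
theorem IsHexEigen.eq_zero (h : IsHexEigen r m d) (hr : 2 ≤ r)
    (h0 : ∀ p ∈ hexagon (8 * r + 8), d p = 0) (p : ℤ × ℤ) : d p = 0 := by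
  have key (k : ℕ) : ∀ p ∈ hexagon (8 * r + 8 + k), d p = 0 := by
    induction k with
    | zero => simpa using h0
    | succ k ih =>
      have := h.eq_zero_on_succ hr (by omega) ih
      rwa [add_assoc] at this
  refine key (p.1.natAbs + p.2.natAbs) p ?_
  rw [mem_hexagon, Nat.cast_add]
  omega

/-! ### Periods of coverings -/

lemma IsCodeCovering.sum_indicator {b a : ℕ} {S : Set (ℤ × ℤ)}
    (hS : IsCodeCovering triangularGrid r b a S) (z : ℤ × ℤ) :
    ∑ k ∈ hexagon r, S.indicator (1 : ℤ × ℤ → ℤ) (z + k) =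
      a + ((b : ℤ) - a) * S.indicator (1 : ℤ × ℤ → ℤ) z := by
  classical
  have hset : neighborhood triangularGrid r z ∩ S =
      (((hexagon r).filter fun k => z + k ∈ S).image (z + ·) : Finset (ℤ × ℤ)) := by
    ext v
    simp only [Set.mem_inter_iff, mem_neighborhood_triangularGrid, Finset.coe_image,
      Finset.coe_filter, Set.mem_image, Set.mem_ofPred_eq]
    constructor
    · rintro ⟨h1, h2⟩
      exact ⟨v - z, ⟨h1, by rwa [add_sub_cancel]⟩, add_sub_cancel _ _⟩
    · rintro ⟨k, ⟨h1, h2⟩, rfl⟩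
      exact ⟨by rwa [add_sub_cancel_left], h2⟩
  have hsum : ∑ k ∈ hexagon r, S.indicator (1 : ℤ × ℤ → ℤ) (z + k) =
      ((hexagon r).filter fun k => z + k ∈ S).card := by
    simp [Set.indicator_apply, Finset.sum_boole]
  have hcov := hS z
  rw [hset, Set.encard_coe_eq_coe_finsetCard,
    Finset.card_image_of_injective _ (add_right_injective z)] at hcov
  rw [hsum]
  by_cases hz : z ∈ S
  · have : ((hexagon r).filter fun k => z + k ∈ S).card = b := by exact_mod_cast hcov.1 hz
    simp [this, hz]
  · have : ((hexagon r).filter fun k => z + k ∈ S).card = a := by exact_mod_cast hcov.2 hz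
    simp [this, hz]

/-- By the pigeonhole principle, two translates of `S` by multiples of `t` agree on the hexagon
that determines a covering, hence everywhere. -/
theorem IsCodeCovering.exists_period {b a : ℕ} {S : Set (ℤ × ℤ)} (hr : 2 ≤ r)
    (hS : IsCodeCovering triangularGrid r b a S) (t : ℤ × ℤ) :
    ∃ k : ℤ, k ≠ 0 ∧ ∀ p, p + k • t ∈ S ↔ p ∈ S := by
  obtain ⟨i, j, hij, heq⟩ := Finite.exists_ne_map_eq_of_infinite
    (fun k : ℤ => ({p | p.1 + k • t ∈ S} : Set (hexagon (8 * r + 8))))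
  let F : ℤ × ℤ → ℤ := S.indicator 1
  have hF (p : ℤ × ℤ) : F p = 0 ∨ F p = 1 := by
    by_cases hp : p ∈ S <;> simp [F, hp]
  have hd : IsHexEigen r (b - a) fun p => F (p + i • t) - F (p + j • t) := by
    refine ⟨fun z => ?_, fun z => ?_⟩
    · rcases hF (z + i • t) with h1 | h1 <;> rcases hF (z + j • t) with h2 | h2 <;>
        simp only [h1, h2] <;> decide
    · have h1 := hS.sum_indicator (z + i • t)
      have h2 := hS.sum_indicator (z + j • t)
      rw [Finset.sum_sub_distrib]
      simp only [add_right_comm z _ _] at h1 h2 ⊢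
      linear_combination h1 - h2
  have hmem {p q : ℤ × ℤ} : F p - F q = 0 ↔ (p ∈ S ↔ q ∈ S) := by
    by_cases hp : p ∈ S <;> by_cases hq : q ∈ S <;> simp [F, hp, hq]
  have hzero := hd.eq_zero hr fun p hp => hmem.2 (Set.ext_iff.1 heq ⟨p, hp⟩)
  refine ⟨i - j, sub_ne_zero.2 hij, fun p => ?_⟩
  have := hmem.1 (hzero (p - j • t))
  rwa [sub_add_cancel, sub_add_eq_add_sub, add_sub_assoc, ← sub_smul] at this

theorem IsCodeCovering.codeTwoPeriodic {b a : ℕ} {S : Set (ℤ × ℤ)} (hr : 2 ≤ r)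
    (hS : IsCodeCovering triangularGrid r b a S) : CodeTwoPeriodic S := by
  obtain ⟨k, hk, hkS⟩ := hS.exists_period hr (1, 0)
  obtain ⟨l, hl, hlS⟩ := hS.exists_period hr (0, 1)
  have himage {t : ℤ × ℤ} (ht : ∀ p, p + t ∈ S ↔ p ∈ S) : S = (fun s => s + t) '' S := by
    ext p
    refine ⟨fun hp => ⟨p - t, (ht _).1 (by rwa [sub_add_cancel]), sub_add_cancel _ _⟩, ?_⟩
    rintro ⟨s, hs, rfl⟩
    exact (ht s).2 hs
  refine ⟨k • (1, 0), l • (0, 1), ?_, himage hkS, himage hlS⟩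
  rw [LinearIndependent.pair_iff]
  intro s t hst
  simpa [hk, hl] using hst

lemma IsConfigCovering.isCodeCovering {b a : ℕ} {c : ℤ × ℤ → Fin 2}
    (hc : IsConfigCovering (neighborhood triangularGrid r (0, 0)) b a c) :
    IsCodeCovering triangularGrid r b a {v | c v = 1} := by
  intro u
  have hset : {v | v ∈ (fun d => u + d) '' neighborhood triangularGrid r (0, 0) ∧ c v = 1} =
      neighborhood triangularGrid r u ∩ {v | c v = 1} := by
    ext v
    refine and_congr_left fun _ => ?_
    rw [mem_neighborhood_triangularGrid]
    constructor
    · rintro ⟨k, hk, rfl⟩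
      rw [mem_neighborhood_triangularGrid] at hk
      rw [Prod.mk_zero_zero, sub_zero] at hk
      rwa [add_sub_cancel_left]
    · intro hv
      refine ⟨v - u, ?_, add_sub_cancel _ _⟩
      rw [mem_neighborhood_triangularGrid]
      rwa [Prod.mk_zero_zero, sub_zero]
  rw [← hset]
  exact ⟨(hc u).1, fun hu => (hc u).2 (by rw [Set.mem_ofPred_eq] at hu; omega)⟩

lemma CodeTwoPeriodic.configTwoPeriodic {c : ℤ × ℤ → Fin 2}
    (h : CodeTwoPeriodic {v | c v = 1}) : ConfigTwoPeriodic c := by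
  have htranslate {t : ℤ × ℤ} (ht : {v | c v = 1} = (fun s => s + t) '' {v | c v = 1}) :
      translate t c = c := by
    funext u
    have hiff : c u = 1 ↔ c (u - t) = 1 := by
      have := Set.ext_iff.1 ht u
      simpa [sub_eq_iff_eq_add, eq_comm, ← sub_eq_add_neg] using this
    rw [translate]
    omega
  obtain ⟨t₁, t₂, hind, h₁, h₂⟩ := h
  exact ⟨t₁, t₂, hind, htranslate h₁, htranslate h₂⟩

end PerfectCovering

theorem mainTheorem7 (r : ℕ) (hr : 2 ≤ r) (b a : ℕ) :
    (∀ c : ℤ × ℤ → Fin 2,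
      PerfectCovering.IsConfigCovering
        (PerfectCovering.neighborhood PerfectCovering.triangularGrid r (0, 0)) b a c →
      PerfectCovering.ConfigTwoPeriodic c) ∧
    (∀ S : Set (ℤ × ℤ),
      PerfectCovering.IsCodeCovering PerfectCovering.triangularGrid r b a S →
      PerfectCovering.CodeTwoPeriodic S) :=
  ⟨fun _ hc => (hc.isCodeCovering.codeTwoPeriodic hr).configTwoPeriodic,
    fun _ hS => hS.codeTwoPeriodic hr⟩
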